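/- Let $H$ be the graph on the vertices $0,1,\dots,5$ consisting of a $K_4$ on $\{0,1,2,3\}$ and two further vertices $4,5$, each joined exactly to the two vertices $1$ and $2$, and let $G$ be the subgraph of $H$ consisting of the single root vertex $0$. For a graph $J$ containing the root vertex $0$, let a $(G,J)$-extension of a vertex $x$ be a copy of $J$ (as a subgraph) in which the root vertex is mapped onto $x$. Let $X_x$ be the number of $(G,H)$-extensions of $x\in[n]$ in the binomial random graph $\mathbb G_{n,p}$. Let $\mu_{G,J}$ be the expected number of $(G,J)$-extensions of a vertex in $\mathbb G_{n,p}$ (it does not depend on the vertex), and write $\mu=\mu_{G,H}=\mathbb E X_x$. Let $\Phi=\min\{\mu_{G,J}: G\subseteq J\subseteq H,\ e_J>e_G\}$, where $e_F$ denotes the number of edges of $F$, and let $\mu_{G,K_4}$ be the expected number of $(G,K_4)$-extensions, with the root being a vertex of $K_4$. Set $\omega:=np^2$. For all $p=p(n)\in[0,1]$ and $\varepsilon=\varepsilon(n)\in(0,1]$ such that, as $n\to\infty$, $\omega\ll(\log n)^{0.39}$ and $\varepsilon^2\omega^3\gg\log n$, we have $$\varepsilon^2\Phi\asymp\varepsilon^2\mu_{G,K_4}\gg\log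 n,$$ but, with probability tending to $1$ as $n\to\infty$, some root $x\in[n]$ satisfies $X_x\ge(1+\varepsilon)\mu$; in particular $$\Pr\Bigl(\max_{x\in[n]}|X_x-\mu|<\varepsilon\mu\Bigr)\to 0.$$ Consequently $\varepsilon^2\Phi\gg\log n$ does not suffice for the $1$-statement: there are $p=p(n)\in[0,1]$ and $\varepsilon=\varepsilon(n)\in(0,1]$ with $\varepsilon^2\Phi\gg\log n$ for which $\Pr(\max_{x\in[n]}|X_x-\mu|<\varepsilon\mu)\not\to1$. -/

import Mathlib

open MeasureTheory Filter Asymptotics Topology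

namespace ExtensionCounts

/-- The subgraph `G` of `H` induced by the root vertices. A rooted graph `(G, H)` with `k` roots
is given by the graph `H` and the injective list `r` of its root vertices. -/
def rootSubgraph {W : Type} {k : ℕ} (H : SimpleGraph W) (r : Fin k ↪ W) : H.Subgraph :=
  (⊤ : H.Subgraph).induce (Set.range r)

/-- The graph `H_G`, with vertex set `V(H)` and edge set `E(H) \ E(G)`. -/
def removeRootEdges {W : Type} {k : ℕ} (H : SimpleGraph W) (r : Fin k ↪ W) : SimpleGraph W :=
  H.deleteEdges (rootSubgraph H r).edgeSet

/-- The number of `(G, H)`-extensions of the root `x` in the graph `Γ`: the number of subgraphs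
of `Γ` that are isomorphic to `H_G` by an isomorphism mapping the `j`-th root vertex to `x j`. -/
noncomputable def extensionCount {W V : Type} {k : ℕ} (H : SimpleGraph W) (r : Fin k ↪ W)
    (x : Fin k ↪ V) (Γ : SimpleGraph V) : ℕ :=
  {S : Γ.Subgraph | ∃ φ : removeRootEdges H r ≃g S.coe, ∀ j, (φ (r j) : V) = x j}.ncard

/-- The expectation `μ_{G,H}` of the number of `(G, H)`-extensions in the binomial random graph
on `n` vertices, computed at the root consisting of the first `k` vertices; by
`integral_extensionCount` it is the same at every root. It is `0` if there is no root. -/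
noncomputable def mean {W : Type} {k : ℕ} (H : SimpleGraph W) (r : Fin k ↪ W)
    (n : ℕ) (p : unitInterval) : ℝ :=
  if h : k ≤ n then
    ∫ Γ, (extensionCount H r (Fin.castLEEmb h) Γ : ℝ) ∂(SimpleGraph.binomialRandom (Fin n) p)
  else 0

/-- The root vertices of `(G, J)`, for a subgraph `J` of `H` that contains `G`. -/
def restrictRoots {W : Type} {k : ℕ} (H : SimpleGraph W) (r : Fin k ↪ W) (J : H.Subgraph)
    (hJ : rootSubgraph H r ≤ J) : Fin k ↪ J.verts where
  toFun j := ⟨r j, hJ.1 ⟨j, rfl⟩⟩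
  inj' _ _ h := r.injective (congrArg Subtype.val h)

/-- `Φ_{G,H}`: the minimum of `μ_{G,J}` over all subgraphs `G ⊆ J ⊆ H` with `e_J > e_G`. -/
noncomputable def Phi {W : Type} {k : ℕ} (H : SimpleGraph W) (r : Fin k ↪ W)
    (n : ℕ) (p : unitInterval) : ℝ :=
  ⨅ J : {J : H.Subgraph // rootSubgraph H r ≤ J ∧
      (rootSubgraph H r).edgeSet.ncard < J.edgeSet.ncard},
    mean J.1.coe (restrictRoots H r J.1 J.2.1) n p

/-- The probability that `max_x |X_x - μ| < ε μ`, where `X_x` is the number of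
`(G, H)`-extensions of `x` in the binomial random graph on `n` vertices. -/
noncomputable def concentrationProb {W : Type} {k : ℕ} (H : SimpleGraph W) (r : Fin k ↪ W)
    (n : ℕ) (p : unitInterval) (ε : ℝ) : ℝ :=
  (SimpleGraph.binomialRandom (Fin n) p).real
    {Γ | (⨆ x : Fin k ↪ Fin n, |(extensionCount H r x Γ : ℝ) - mean H r n p|)
      < ε * mean H r n p}

/-- The probability that some root `x` has at least `(1 + ε) μ` many `(G, H)`-extensions. -/
noncomputable def tooManyProb {W : Type} {k : ℕ} (H : SimpleGraph W) (r : Fin k ↪ W)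
    (n : ℕ) (p : unitInterval) (ε : ℝ) : ℝ :=
  (SimpleGraph.binomialRandom (Fin n) p).real
    {Γ | ∃ x : Fin k ↪ Fin n, (1 + ε) * mean H r n p ≤ (extensionCount H r x Γ : ℝ)}

/-- The list of root vertices consisting of the single vertex `v`. -/
def singleRoot {W : Type} (v : W) : Fin 1 ↪ W where
  toFun _ := v
  inj' _ _ _ := Subsingleton.elim _ _

/-- The graph consisting of a `K₄` on the vertices `0, 1, 2, 3` (with `0` serving as the root)
and of two further vertices `4` and `5`, both joined to the two vertices `1` and `2`. -/
def graphF : SimpleGraph (Fin 6) :=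
  SimpleGraph.fromEdgeSet
    {s(0, 1), s(0, 2), s(0, 3), s(1, 2), s(1, 3), s(2, 3),
      s(1, 4), s(2, 4), s(1, 5), s(2, 5)}

theorem extensionCount_le_of_iso {W V : Type} [Finite V] {k : ℕ} (H : SimpleGraph W)
    (r : Fin k ↪ W) (x : Fin k ↪ V) {Γ Γ' : SimpleGraph V} (f : Γ ≃g Γ') :
    extensionCount H r x Γ ≤ extensionCount H r (x.trans f.toEquiv.toEmbedding) Γ' := by
  classical
  refine Set.ncard_le_ncard_of_injOn (fun S => S.map f.toHom) ?_ ?_ (Set.toFinite _)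
  · rintro S ⟨φ, hφ⟩
    let e : S.verts ≃ (S.map f.toHom).verts := Equiv.Set.image f S.verts f.injective
    have he : ∀ a : S.verts, ((e a : (S.map f.toHom).verts) : V) = f a := fun a => rfl
    refine ⟨φ.trans ⟨e, ?_⟩, ?_⟩
    · intro a b
      rw [SimpleGraph.Subgraph.coe_adj, SimpleGraph.Subgraph.coe_adj, he, he,
        SimpleGraph.Subgraph.map_adj]
      exact Relation.map_apply_apply f.injective f.injective _ _ _
    · intro j
      change f (φ (r j) : V) = f (x j)
      rw [hφ j]
  · intro S _ T _ h
    replace h : S.map f.toHom = T.map f.toHom := h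
    ext a b
    · have h1 := congrArg (fun U => f a ∈ U.verts) h
      exact ((f.injective.mem_set_image).symm.trans (Iff.of_eq h1)).trans
        f.injective.mem_set_image
    · have h1 := congrArg (fun U => U.Adj (f a) (f b)) h
      exact ((Relation.map_apply_apply f.injective f.injective S.Adj a b).symm.trans
        (Iff.of_eq h1)).trans (Relation.map_apply_apply f.injective f.injective T.Adj a b)

theorem measurableSet_singleton_simpleGraph {V : Type} [Finite V] (Γ : SimpleGraph V) :
    MeasurableSet ({Γ} : Set (SimpleGraph V)) := by
  have h : ({Γ} : Set (SimpleGraph V)) = SimpleGraph.edgeSet ⁻¹' {Γ.edgeSet} := by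
    ext Γ'
    simp
  rw [h]
  exact SimpleGraph.measurableEmbedding_edgeSet.measurable (measurableSet_singleton _)

theorem integral_extensionCount {W : Type} {k n : ℕ} (H : SimpleGraph W) (r : Fin k ↪ W)
    (p : unitInterval) (x : Fin k ↪ Fin n) :
    ∫ Γ, (extensionCount H r x Γ : ℝ) ∂(SimpleGraph.binomialRandom (Fin n) p)
      = mean H r n p := by
  classical
  have hk : k ≤ n := by simpa using Fintype.card_le_of_embedding x
  rw [mean, dif_pos hk]
  obtain ⟨σ, hσ⟩ : ∃ σ : Equiv.Perm (Fin n), σ • x = Fin.castLEEmb hk :=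
    (Equiv.Perm.isMultiplyPretransitive (Fin n) k).exists_smul_eq x (Fin.castLEEmb hk)
  have hx : x.trans σ.toEmbedding = Fin.castLEEmb hk := hσ
  have hx' : (Fin.castLEEmb hk).trans σ.symm.toEmbedding = x := by
    rw [← hx]; ext; simp
  have : MeasurableSingletonClass (SimpleGraph (Fin n)) :=
    ⟨measurableSet_singleton_simpleGraph⟩
  rw [integral_fintype .of_finite, integral_fintype .of_finite]
  refine Fintype.sum_equiv (Equiv.simpleGraph σ) _ _ fun Γ => ?_
  let f : Γ ≃g Equiv.simpleGraph σ Γ := (SimpleGraph.Iso.comap σ.symm Γ).symm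
  have hf : f.toEquiv = σ := rfl
  have hf' : f.symm.toEquiv = σ.symm := rfl
  congr 1
  · simp only [Measure.real, SimpleGraph.binomialRandom_singleton]
    rw [Set.ncard_congr' f.mapEdgeSet]
  · have h1 := extensionCount_le_of_iso H r x f
    have h2 := extensionCount_le_of_iso H r (Fin.castLEEmb hk) f.symm
    rw [hf, hx] at h1
    rw [hf', hx'] at h2
    exact_mod_cast le_antisymm h1 h2

end ExtensionCounts

open ExtensionCounts

namespace ExtensionCounts

open ProbabilityTheory

/-! Write ω = np² and L = log n. A (G,H)-extension has five non-root vertices and ten edges, so μ ≤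
ω⁵ ≤ L^1.95. One root with that many extensions can be produced by a single sparse structure:
`bookGraph (2 * D + 4)`, a K₄ on 0, 1, 2, 3 together with 2D further vertices ("pages") joined to
both 1 and 2. Picking one page from each of two blocks of D gives D² extensions of the image of 0
(`sq_le_extensionCount`). With D about L^0.98 this is at least L^1.96, which eventually exceeds 2μ ≥
(1+ε)μ.

Such a book exists with high probability. It has k = 2D+4 vertices, and every nonempty vertex set S
spans at most 2|S|-2 edges (`ncard_edgeSet_bookGraph_inter_sym2_le`), with equality for the whole
book. Hence the expected number of copies is of the form (bp²)^k/p² with b about n/k, and the second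
moment method bounds the failure probability by p²(1+2k)^k (`one_sub_le_measureReal_exists_copy`,
`one_sub_le_tooManyProb`). As k is at most of order L^0.98, k log k is o(L), so (1+2k)^k ≤ n^(1/2),
while p² = ω/n ≤ L/n.

Meanwhile Φ has order ω³: if J has a non-root vertices and e edges, the same density bound gives e ≤
2a, and n^a p^e is then at least ω³, with the order attained by K₄ (`le_Phi_graphF`,
`Phi_graphF_le`). -/

/-! ### Containment probabilities and the second moment inequality -/

theorem measureReal_binomialRandom_subset_edgeSet {V : Type} [Finite V] (p : unitInterval)
    (T : Finset (Sym2 V)) (hT : ∀ e ∈ T, ¬ e.IsDiag) :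
    (SimpleGraph.binomialRandom V p).real {Γ | (T : Set (Sym2 V)) ⊆ Γ.edgeSet}
      = (p : ℝ) ^ T.card := by
  have h1 : (SimpleGraph.binomialRandom V p) {Γ | (T : Set (Sym2 V)) ⊆ Γ.edgeSet}
      = setBernoulli (Sym2.diagSetᶜ : Set (Sym2 V)) p {s | (T : Set (Sym2 V)) ⊆ s} := by
    rw [SimpleGraph.binomialRandom_apply']
    -- A Bernoulli set almost surely avoids the diagonal, hence is the edge set of a graph; what
    -- remains is a cylinder event of a product measure.
    refine measure_congr ?_
    filter_upwards [setBernoulli_ae_subset] with s hs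
    refine propext ⟨?_, fun h => ⟨SimpleGraph.fromEdgeSet s, ?_, ?_⟩⟩
    · rintro ⟨Γ, hΓ, rfl⟩
      exact hΓ
    · have : s \ Sym2.diagSet = s := sdiff_eq_left.2 (Set.subset_compl_iff_disjoint_right.1 hs)
      change (T : Set (Sym2 V)) ⊆ (SimpleGraph.fromEdgeSet s).edgeSet
      rw [SimpleGraph.edgeSet_fromEdgeSet, this]
      exact h
    · have : s \ Sym2.diagSet = s := sdiff_eq_left.2 (Set.subset_compl_iff_disjoint_right.1 hs)
      simpa using this
  have h2 : (fun q : Sym2 V → Prop => {i | q i}) ⁻¹' {s | (T : Set (Sym2 V)) ⊆ s}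
      = Set.pi (T : Set (Sym2 V)) (fun _ => {True}) := by
    ext q
    simp [Set.subset_def, Set.mem_pi]
  rw [Measure.real, h1, setBernoulli_apply', h2, Measure.infinitePi_pi _ (by simp)]
  rw [Finset.prod_congr rfl (g := fun _ => ((unitInterval.toNNReal p : NNReal) : ENNReal))]
  · simp
  · intro e he
    have := hT e he
    simp [this]

/-- Cauchy–Schwarz for N = N · 1_{N > 0}, where N counts the events that occur; on a finite space it
is a weighted inequality over atoms. -/
theorem sq_sum_measureReal_le {Ω ι : Type*} [Fintype Ω] [MeasurableSpace Ω]
    [MeasurableSingletonClass Ω] (μ : Measure Ω) [IsFiniteMeasure μ] [Fintype ι]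
    (A : ι → Set Ω) :
    (∑ i, μ.real (A i)) ^ 2 ≤ μ.real (⋃ i, A i) * ∑ i, ∑ j, μ.real (A i ∩ A j) := by
  classical
  have hS : ∀ S : Set Ω, μ.real S = ∑ x, μ.real {x} * S.indicator 1 x := by
    intro S
    have h := sum_measureReal_singleton (μ := μ) (Finset.univ.filter (· ∈ S))
    rw [Finset.sum_filter] at h
    simp only [Finset.coe_filter, Finset.mem_univ, true_and, Set.ofPred_mem_eq] at h
    simp [Set.indicator_apply, ← h]
  have h1 : ∑ i, μ.real (A i) = ∑ x, μ.real {x} * ∑ i, (A i).indicator 1 x := by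
    simp_rw [Finset.mul_sum]
    rw [Finset.sum_comm]
    exact Finset.sum_congr rfl fun i _ => hS _
  have h2 : ∑ i, ∑ j, μ.real (A i ∩ A j)
      = ∑ x, μ.real {x} * (∑ i, (A i).indicator 1 x) ^ 2 := by
    simp_rw [pow_two, Finset.sum_mul_sum, Finset.mul_sum]
    rw [Finset.sum_comm]
    simp_rw [hS (_ ∩ _), Set.inter_indicator_one, Pi.mul_apply]
    rw [Finset.sum_comm]
    refine (Finset.sum_congr rfl fun i _ => Finset.sum_comm).trans ?_
    rw [Finset.sum_comm]
  rw [h1, h2, hS]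
  refine Finset.sum_sq_le_sum_mul_sum_of_sq_le_mul _ (fun x _ => ?_) (fun x _ => ?_) fun x _ => ?_
  · exact mul_nonneg measureReal_nonneg (Set.indicator_nonneg (by simp) _)
  · positivity
  · by_cases hx : x ∈ ⋃ i, A i
    · rw [Set.indicator_of_mem hx]
      simp only [Pi.one_apply]
      exact le_of_eq (by ring)
    · have : ∀ i, x ∉ A i := by simpa using hx
      simp [this]

/-! ### Extension counts versus embeddings -/

/-- The edges of the image of `F` under the embedding `g` of the vertices. -/
noncomputable def copyEdges {W V : Type} [Finite W] (F : SimpleGraph W) (g : W ↪ V) :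
    Finset (Sym2 V) :=
  (Set.toFinite F.edgeSet).toFinset.map g.sym2Map

theorem card_copyEdges {W V : Type} [Finite W] (F : SimpleGraph W) (g : W ↪ V) :
    (copyEdges F g).card = F.edgeSet.ncard := by
  rw [copyEdges, Finset.card_map, Set.ncard_eq_toFinset_card]

theorem not_isDiag_of_mem_copyEdges {W V : Type} [Finite W] (F : SimpleGraph W) (g : W ↪ V) :
    ∀ e ∈ copyEdges F g, ¬ e.IsDiag := by
  intro e he
  obtain ⟨d, hd, rfl⟩ := Finset.mem_map.1 he
  induction d with | _ a b =>
  have : F.Adj a b := by simpa using hd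
  simpa using this.ne

theorem copyEdges_subset_iff {W V : Type} [Finite W] {F : SimpleGraph W} {g : W ↪ V}
    {Γ : SimpleGraph V} :
    (copyEdges F g : Set (Sym2 V)) ⊆ Γ.edgeSet ↔ ∀ a b, F.Adj a b → Γ.Adj (g a) (g b) := by
  constructor
  · intro h a b hab
    exact h (Finset.mem_map.2 ⟨s(a, b), by simpa using hab, rfl⟩)
  · intro h e he
    obtain ⟨d, hd, rfl⟩ := Finset.mem_map.1 (Finset.mem_coe.1 he)
    induction d with | _ a b =>
    exact h a b (by simpa using hd)

theorem measureReal_copyEdges_subset {W V : Type} [Finite W] [Finite V] (F : SimpleGraph W)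
    (g : W ↪ V) (p : unitInterval) :
    (SimpleGraph.binomialRandom V p).real {Γ | (copyEdges F g : Set (Sym2 V)) ⊆ Γ.edgeSet}
      = (p : ℝ) ^ F.edgeSet.ncard := by
  rw [measureReal_binomialRandom_subset_edgeSet p _ (not_isDiag_of_mem_copyEdges F g),
    card_copyEdges]

theorem removeRootEdges_of_subsingleton {W : Type} (H : SimpleGraph W) (r : Fin 1 ↪ W) :
    removeRootEdges H r = H := by
  rw [removeRootEdges, SimpleGraph.deleteEdges_eq_self, Set.disjoint_left]
  rintro e - he
  induction e with | _ a b =>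
  have : (rootSubgraph H r).Adj a b := he
  simp only [rootSubgraph, SimpleGraph.Subgraph.induce_adj, Set.mem_range,
    SimpleGraph.Subgraph.top_adj] at this
  obtain ⟨⟨i, rfl⟩, ⟨j, rfl⟩, h⟩ := this
  exact h.ne (by rw [Subsingleton.elim i j])

/-- Requiring distinct vertex sets makes the copies distinct as subgraphs, so automorphisms of `H`
cause no overcounting. -/
theorem card_le_extensionCount {W V ι : Type} [Finite V] (H : SimpleGraph W) (r : Fin 1 ↪ W)
    (x : Fin 1 ↪ V) (Γ : SimpleGraph V) (s : Finset ι) (φ : ι → W ↪ V)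
    (hφ : ∀ i ∈ s, ∀ a b, H.Adj a b → Γ.Adj (φ i a) (φ i b))
    (hr : ∀ i ∈ s, φ i (r 0) = x 0)
    (hs : Set.InjOn (fun i => Set.range (φ i)) (s : Set ι)) :
    s.card ≤ extensionCount H r x Γ := by
  have key : ∀ i, i ∈ s → ∃ S : Γ.Subgraph, S.verts = Set.range (φ i) ∧
      ∃ ψ : H ≃g S.coe, ∀ j, (ψ (r j) : V) = x j := by
    intro i hi
    let f : SimpleGraph.Copy H Γ := ⟨⟨φ i, fun {a b} h => hφ i hi a b h⟩, (φ i).injective⟩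
    refine ⟨f.toSubgraph, ?_, f.isoToSubgraph, fun j => ?_⟩
    · ext v
      simp [SimpleGraph.Copy.toSubgraph, f]
    · rw [Subsingleton.elim j 0]
      exact hr i hi
  choose! S hS hS' using key
  rw [← Set.ncard_coe_finset, extensionCount, removeRootEdges_of_subsingleton]
  refine Set.ncard_le_ncard_of_injOn S (fun i hi => hS' i hi) ?_ (Set.toFinite _)
  intro i hi j hj hij
  refine hs hi hj ?_
  change Set.range (φ i) = Set.range (φ j)
  rw [← hS i hi, ← hS j hj, hij]

/-- Choose one parametrisation for each copy; the copy is recovered from it as the image of `H`, so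
the choice is injective. -/
theorem extensionCount_le_ncard {W V : Type} [Finite W] [Finite V] (H : SimpleGraph W)
    (r : Fin 1 ↪ W) (x : Fin 1 ↪ V) (Γ : SimpleGraph V) :
    extensionCount H r x Γ ≤
      {g : W ↪ V | g (r 0) = x 0 ∧ (copyEdges H g : Set (Sym2 V)) ⊆ Γ.edgeSet}.ncard := by
  rw [extensionCount, removeRootEdges_of_subsingleton]
  have key : ∀ S : Γ.Subgraph, (∃ ψ : H ≃g S.coe, ∀ j, (ψ (r j) : V) = x j) →
      ∃ g : W ↪ V, g (r 0) = x 0 ∧ S.verts = Set.range g ∧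
        ∀ a b, H.Adj a b ↔ S.Adj (g a) (g b) := by
    rintro S ⟨ψ, hψ⟩
    refine ⟨ψ.toEquiv.toEmbedding.trans (Function.Embedding.subtype _), hψ 0, ?_, ?_⟩
    · ext v
      constructor
      · intro hv
        exact ⟨ψ.symm ⟨v, hv⟩, by simp⟩
      · rintro ⟨w, rfl⟩
        exact (ψ w).2
    · intro a b
      exact (ψ.map_rel_iff (a := a) (b := b)).symm
  obtain h0 | ⟨S₀, hS₀⟩ := Set.eq_empty_or_nonempty
      {S : Γ.Subgraph | ∃ ψ : H ≃g S.coe, ∀ j, (ψ (r j) : V) = x j}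
  · rw [h0, Set.ncard_empty]
    exact Nat.zero_le _
  have : Nonempty (W ↪ V) := ⟨(key S₀ hS₀).choose⟩
  choose! g hg hg' hg'' using key
  refine Set.ncard_le_ncard_of_injOn g (fun S hS => ⟨hg S hS, ?_⟩) ?_ (Set.toFinite _)
  · rw [copyEdges_subset_iff]
    exact fun a b h => ((hg'' S hS a b).1 h).adj_sub
  · intro S hS T hT hST
    have hv : S.verts = T.verts := by rw [hg' S hS, hg' T hT, hST]
    have aux : ∀ S T : Γ.Subgraph, (∃ ψ : H ≃g S.coe, ∀ j, (ψ (r j) : V) = x j) →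
        (∃ ψ : H ≃g T.coe, ∀ j, (ψ (r j) : V) = x j) → g S = g T →
        ∀ u v, S.Adj u v → T.Adj u v := by
      intro S T hS hT hST u v h
      have hu := S.edge_vert h
      have hv := S.edge_vert h.symm
      rw [hg' S hS] at hu hv
      obtain ⟨a, rfl⟩ := hu
      obtain ⟨b, rfl⟩ := hv
      rw [hST, ← hg'' T hT, hg'' S hS]
      exact h
    ext u v
    · rw [hv]
    · exact ⟨aux S T hS hT hST u v, aux T S hT hS hST.symm u v⟩

/-! ### Upper and lower bounds for the mean -/

theorem card_embedding_root_le {W V : Type} [Fintype W] [Fintype V] (w : W) (v : V) :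
    {g : W ↪ V | g w = v}.ncard ≤ Fintype.card V ^ (Fintype.card W - 1) := by
  classical
  refine (Set.ncard_le_ncard_of_injOn (t := ((Fintype.piFinset
    fun a => if a = w then {v} else Finset.univ : Finset (W → V)) : Set (W → V)))
    (fun g : W ↪ V => (g : W → V)) ?_
    (DFunLike.coe_injective (F := W ↪ V)).injOn (Set.toFinite _)).trans ?_
  · intro g hg
    simp only [Finset.mem_coe, Fintype.mem_piFinset]
    intro a
    split_ifs with h
    · simpa [h] using hg
    · simp
  · rw [Set.ncard_coe_finset, Fintype.card_piFinset]
    simp_rw [apply_ite Finset.card, Finset.card_singleton, Finset.card_univ]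
    rw [Finset.prod_ite]
    simp [Finset.filter_ne']

instance instMeasurableSingletonClassSimpleGraph {V : Type} [Finite V] :
    MeasurableSingletonClass (SimpleGraph V) :=
  ⟨measurableSet_singleton_simpleGraph⟩

theorem integral_card_filter {Ω ι : Type*} [MeasurableSpace Ω] [Finite Ω]
    [MeasurableSingletonClass Ω] (μ : Measure Ω) [IsFiniteMeasure μ] (s : Finset ι)
    (A : ι → Set Ω) :
    ∫ ω, ((({i | i ∈ s ∧ ω ∈ A i} : Set ι).ncard : ℕ) : ℝ) ∂μ = ∑ i ∈ s, μ.real (A i) := by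
  classical
  have h : ∀ ω, ((({i | i ∈ s ∧ ω ∈ A i} : Set ι).ncard : ℕ) : ℝ)
      = ∑ i ∈ s, (A i).indicator 1 ω := by
    intro ω
    have : ({i | i ∈ s ∧ ω ∈ A i} : Set ι) = (s.filter (fun i => ω ∈ A i) : Finset ι) := by
      ext; simp
    rw [this, Set.ncard_coe_finset]
    simp [Set.indicator_apply]
  simp_rw [h]
  rw [integral_finsetSum _ fun i _ => .of_finite]
  exact Finset.sum_congr rfl fun i _ => integral_indicator_one (Set.toFinite _).measurableSet

theorem mean_le {W : Type} [Fintype W] (H : SimpleGraph W) (r : Fin 1 ↪ W) (n : ℕ)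
    (p : unitInterval) :
    mean H r n p ≤ (n : ℝ) ^ (Fintype.card W - 1) * (p : ℝ) ^ H.edgeSet.ncard := by
  classical
  have hp := p.2.1
  by_cases hn : 1 ≤ n
  swap
  · rw [mean, dif_neg hn]
    positivity
  let x : Fin 1 ↪ Fin n := Fin.castLEEmb hn
  rw [← integral_extensionCount H r p x]
  let s : Finset (W ↪ Fin n) := Finset.univ.filter fun g => g (r 0) = x 0
  have hs : (s.card : ℝ) ≤ (n : ℝ) ^ (Fintype.card W - 1) := by
    have := card_embedding_root_le (r 0) (x 0)
    rw [Fintype.card_fin] at this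
    rw [← Set.ncard_coe_finset]
    simpa [s] using mod_cast this
  calc _ ≤ ∫ Γ, ((({g | g ∈ s ∧ Γ ∈ {Γ : SimpleGraph (Fin n) |
          (copyEdges H g : Set (Sym2 (Fin n))) ⊆ Γ.edgeSet}} :
            Set (W ↪ Fin n)).ncard : ℕ) : ℝ) ∂(SimpleGraph.binomialRandom (Fin n) p) := by
        refine integral_mono .of_finite .of_finite fun Γ => ?_
        have := extensionCount_le_ncard H r x Γ
        simpa [s] using mod_cast this
    _ = s.card * (p : ℝ) ^ H.edgeSet.ncard := by
        rw [integral_card_filter]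
        simp_rw [measureReal_copyEdges_subset]
        simp
    _ ≤ _ := by gcongr

/-- The embedding that maps each `w` into its own class of `b` vertices, according to `f`. -/
def partiteEmbedding {W V : Type} {b : ℕ} (place : W × Fin b ↪ V) (f : W → Fin b) : W ↪ V where
  toFun w := place (w, f w)
  inj' _ _ h := congrArg Prod.fst (place.injective h)

theorem range_partiteEmbedding_injective {W V : Type} {b : ℕ} (place : W × Fin b ↪ V) :
    Function.Injective fun f : W → Fin b => Set.range (partiteEmbedding place f) := by
  intro f g h
  funext w
  have : partiteEmbedding place f w ∈ Set.range (partiteEmbedding place g) := by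
    rw [← show Set.range (partiteEmbedding place f) = Set.range (partiteEmbedding place g) from h]
    exact ⟨w, rfl⟩
  obtain ⟨v, hv⟩ := this
  have := place.injective hv
  rw [Prod.mk.injEq] at this
  obtain ⟨rfl, h⟩ := this
  exact h.symm

/-- Only partite copies are counted: each vertex of `W` has its own class of `b` vertices, and the
root is fixed. Different choices have different vertex sets. -/
theorem le_mean {W : Type} [Fintype W] (H : SimpleGraph W) (r : Fin 1 ↪ W) (n b : ℕ)
    (hb : 0 < b) (hbn : Fintype.card W * b ≤ n) (p : unitInterval) :
    (b : ℝ) ^ (Fintype.card W - 1) * (p : ℝ) ^ H.edgeSet.ncard ≤ mean H r n p := by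
  classical
  obtain ⟨place⟩ : Nonempty (W × Fin b ↪ Fin n) :=
    Function.Embedding.nonempty_of_card_le (by simpa using hbn)
  let x : Fin 1 ↪ Fin n := singleRoot (place (r 0, ⟨0, hb⟩))
  rw [← integral_extensionCount H r p x]
  let s : Finset (W → Fin b) :=
    Fintype.piFinset fun a => if a = r 0 then {⟨0, hb⟩} else Finset.univ
  have hs : s.card = b ^ (Fintype.card W - 1) := by
    rw [Fintype.card_piFinset]
    simp_rw [apply_ite Finset.card, Finset.card_singleton, Finset.card_univ]
    rw [Finset.prod_ite]
    simp [Finset.filter_ne']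
  calc _ = ∫ Γ, ((({f | f ∈ s ∧ Γ ∈ {Γ : SimpleGraph (Fin n) |
          (copyEdges H (partiteEmbedding place f) : Set (Sym2 (Fin n))) ⊆ Γ.edgeSet}} :
            Set (W → Fin b)).ncard : ℕ) : ℝ) ∂(SimpleGraph.binomialRandom (Fin n) p) := by
        rw [integral_card_filter]
        simp_rw [measureReal_copyEdges_subset]
        simp [hs]
    _ ≤ _ := by
        refine integral_mono .of_finite .of_finite fun Γ => ?_
        have := card_le_extensionCount H r x Γ (s.filter fun f =>
          (copyEdges H (partiteEmbedding place f) : Set (Sym2 (Fin n))) ⊆ Γ.edgeSet)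
          (partiteEmbedding place) (fun f hf => copyEdges_subset_iff.1 (Finset.mem_filter.1 hf).2)
          (fun f hf => ?_) (range_partiteEmbedding_injective place).injOn
        · rw [← Set.ncard_coe_finset, Finset.coe_filter] at this
          exact Nat.cast_le.2 this
        · have h := Fintype.mem_piFinset.1 (Finset.mem_filter.1 hf).1 (r 0)
          simp only [if_true, Finset.mem_singleton] at h
          change place (r 0, f (r 0)) = place (r 0, ⟨0, hb⟩)
          rw [h]

/-! ### Second moment method for copies of a sparse graph -/

/-- The classes are disjoint, so a vertex common to both copies plays the same role `w` in each and
satisfies `f w = g w`; a common edge has both ends of this kind. -/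
theorem card_copyEdges_inter_le {W V : Type} [Fintype W] [DecidableEq W] [DecidableEq V] {b : ℕ}
    (F : SimpleGraph W) (place : W × Fin b ↪ V) (f g : W → Fin b) :
    (copyEdges F (partiteEmbedding place f) ∩ copyEdges F (partiteEmbedding place g)).card ≤
      {e ∈ F.edgeSet | e ∈ (Finset.univ.filter fun w => f w = g w).sym2}.ncard := by
  rw [← Set.ncard_coe_finset]
  rw [← Set.ncard_image_of_injective _ (partiteEmbedding place f).sym2Map.injective]
  refine Set.ncard_le_ncard ?_ (Set.toFinite _)
  intro e he
  rw [Finset.mem_coe, Finset.mem_inter] at he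
  obtain ⟨⟨d, hd, rfl⟩, ⟨d', hd', hdd⟩⟩ :=
    And.intro (Finset.mem_map.1 he.1) (Finset.mem_map.1 he.2)
  refine ⟨d, ⟨by simpa using hd, ?_⟩, rfl⟩
  induction d with | _ u v =>
  induction d' with | _ u' v' =>
  have hp : ∀ w w', partiteEmbedding place g w' = partiteEmbedding place f w → f w = g w := by
    intro w w' h
    have := place.injective h
    rw [Prod.mk.injEq] at this
    obtain ⟨rfl, h⟩ := this
    exact h.symm
  have hdd : s(partiteEmbedding place g u', partiteEmbedding place g v')
      = s(partiteEmbedding place f u, partiteEmbedding place f v) := hdd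
  rw [Sym2.eq_iff] at hdd
  rw [Finset.mk_mem_sym2_iff]
  rcases hdd with ⟨h1, h2⟩ | ⟨h1, h2⟩
  · simp [hp _ _ h1, hp _ _ h2]
  · simp [hp _ _ h1, hp _ _ h2]

/-- If the copies agree exactly on S, they share i edges, at most 2|S|-2 when S is nonempty, so the
correlation factor p^(-i) is at most p² · p^(-2|S|). The term 1 covers empty S. The product over `w`
is what lets the sum over `g` factorise later. -/
theorem measureReal_inter_copyEdges_le {W V : Type} [Fintype W] [DecidableEq W] [Finite V]
    {b : ℕ} (F : SimpleGraph W)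
    (hF : ∀ S : Finset W, S.Nonempty → {e ∈ F.edgeSet | e ∈ S.sym2}.ncard + 2 ≤ 2 * S.card)
    (place : W × Fin b ↪ V) (p : unitInterval) (hp : 0 < (p : ℝ)) (f g : W → Fin b) :
    (SimpleGraph.binomialRandom V p).real
      ({Γ | (copyEdges F (partiteEmbedding place f) : Set (Sym2 V)) ⊆ Γ.edgeSet} ∩
        {Γ | (copyEdges F (partiteEmbedding place g) : Set (Sym2 V)) ⊆ Γ.edgeSet}) ≤
      ((p : ℝ) ^ F.edgeSet.ncard) ^ 2 *
        (1 + (p : ℝ) ^ 2 * ∏ w, if f w = g w then ((p : ℝ) ^ 2)⁻¹ else 1) := by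
  classical
  have h1 : ({Γ : SimpleGraph V |
        (copyEdges F (partiteEmbedding place f) : Set (Sym2 V)) ⊆ Γ.edgeSet} ∩
        {Γ | (copyEdges F (partiteEmbedding place g) : Set (Sym2 V)) ⊆ Γ.edgeSet}) =
      {Γ | ((copyEdges F (partiteEmbedding place f) ∪ copyEdges F (partiteEmbedding place g) :
        Finset (Sym2 V)) : Set (Sym2 V)) ⊆ Γ.edgeSet} := by
    ext Γ
    simp only [Finset.coe_union, Set.union_subset_iff]
    rfl
  rw [h1, measureReal_binomialRandom_subset_edgeSet]
  swap
  · intro e he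
    rcases Finset.mem_union.1 he with he | he
    exacts [not_isDiag_of_mem_copyEdges _ _ e he, not_isDiag_of_mem_copyEdges _ _ e he]
  set S : Finset W := Finset.univ.filter fun w => f w = g w with hS
  have h2 := card_copyEdges_inter_le F place f g
  rw [← hS] at h2
  have h3 := Finset.card_union_add_card_inter (copyEdges F (partiteEmbedding place f))
    (copyEdges F (partiteEmbedding place g))
  rw [card_copyEdges, card_copyEdges] at h3
  have h4 : (∏ w, if f w = g w then ((p : ℝ) ^ 2)⁻¹ else 1) = (((p : ℝ) ^ 2)⁻¹) ^ S.card := by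
    rw [Finset.prod_ite]
    simp [hS]
  set c := (copyEdges F (partiteEmbedding place f) ∪ copyEdges F (partiteEmbedding place g)).card
  set i := (copyEdges F (partiteEmbedding place f) ∩ copyEdges F (partiteEmbedding place g)).card
  rw [h4]
  have hp1 : (p : ℝ) ≤ 1 := p.2.2
  have hprod : ((p : ℝ) ^ F.edgeSet.ncard) ^ 2 = (p : ℝ) ^ c * (p : ℝ) ^ i := by
    rw [← pow_mul, ← pow_add, h3, mul_two]
  rw [hprod, mul_assoc]
  refine le_mul_of_one_le_right (by positivity) ?_
  rcases S.eq_empty_or_nonempty with h0 | h0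
  · have : i = 0 := by simpa [h0] using h2
    rw [this, pow_zero, one_mul]
    exact le_add_of_nonneg_right (by positivity)
  · have h5 : i + 2 ≤ 2 * S.card := (Nat.add_le_add_right h2 2).trans (hF S h0)
    calc (1 : ℝ) = (p : ℝ) ^ (2 * S.card) * (((p : ℝ) ^ 2)⁻¹) ^ S.card := by
          rw [pow_mul, ← mul_pow, mul_inv_cancel₀ (by positivity), one_pow]
      _ ≤ (p : ℝ) ^ (i + 2) * (((p : ℝ) ^ 2)⁻¹) ^ S.card := by
          gcongr ?_ * _
          exact pow_le_pow_of_le_one hp.le hp1 h5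
      _ = (p : ℝ) ^ i * ((p : ℝ) ^ 2 * (((p : ℝ) ^ 2)⁻¹) ^ S.card) := by ring
      _ ≤ _ := by gcongr; linarith

theorem one_sub_le_measureReal_exists_copy {W V : Type} [Fintype W] [DecidableEq W] [Finite V]
    {b : ℕ} (hb : 0 < b) (F : SimpleGraph W)
    (hF : ∀ S : Finset W, S.Nonempty → {e ∈ F.edgeSet | e ∈ S.sym2}.ncard + 2 ≤ 2 * S.card)
    (place : W × Fin b ↪ V) (p : unitInterval) (hp : 0 < (p : ℝ)) :
    1 - (p : ℝ) ^ 2 * (1 + (b * (p : ℝ) ^ 2)⁻¹) ^ Fintype.card W ≤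
      (SimpleGraph.binomialRandom V p).real
        {Γ | ∃ g : W ↪ V, ∀ a b, F.Adj a b → Γ.Adj (g a) (g b)} := by
  classical
  have := Fintype.ofFinite (SimpleGraph V)
  set μ := SimpleGraph.binomialRandom V p
  set q : ℝ := (p : ℝ) ^ F.edgeSet.ncard with hq
  set k := Fintype.card W with hk
  set t : ℝ := (p : ℝ) ^ 2 * (1 + (b * (p : ℝ) ^ 2)⁻¹) ^ k with ht
  let A : (W → Fin b) → Set (SimpleGraph V) := fun f =>
    {Γ | (copyEdges F (partiteEmbedding place f) : Set (Sym2 V)) ⊆ Γ.edgeSet}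
  have hb' : (0 : ℝ) < b := mod_cast hb
  have hq0 : 0 < q := by positivity
  have ht0 : 0 < t := by positivity
  have h1 : ∑ f, μ.real (A f) = (b : ℝ) ^ k * q := by
    simp_rw [A, μ, measureReal_copyEdges_subset]
    simp [hk, hq]
  have h2 : ∑ f, ∑ g, μ.real (A f ∩ A g) ≤ ((b : ℝ) ^ k * q) ^ 2 * (1 + t) := by
    have h3 : ∀ f : W → Fin b,
        ∑ g : W → Fin b, (∏ w, if f w = g w then ((p : ℝ) ^ 2)⁻¹ else 1)
          ≤ (b + ((p : ℝ) ^ 2)⁻¹) ^ k := by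
      intro f
      -- The sum over all `g` of the product is a product over `w` of sums over `Fin b`, each at
      -- most b + p⁻².
      rw [← Fintype.piFinset_univ, ← Finset.prod_univ_sum (fun _ => Finset.univ)
        (fun w a => if f w = a then ((p : ℝ) ^ 2)⁻¹ else 1)]
      rw [hk, ← Finset.card_univ, ← Finset.prod_const]
      refine Finset.prod_le_prod (fun w _ => Finset.sum_nonneg fun a _ => ?_) fun w _ => ?_
      · split_ifs <;> positivity
      · calc _ ≤ ∑ a : Fin b, (1 + if f w = a then ((p : ℝ) ^ 2)⁻¹ else 0) := by
              refine Finset.sum_le_sum fun a _ => ?_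
              split_ifs <;> simp
          _ = _ := by rw [Finset.sum_add_distrib]; simp
    calc _ ≤ ∑ f : W → Fin b, ∑ g : W → Fin b, q ^ 2 * (1 + (p : ℝ) ^ 2 *
          ∏ w, if f w = g w then ((p : ℝ) ^ 2)⁻¹ else 1) :=
          Finset.sum_le_sum fun f _ => Finset.sum_le_sum fun g _ =>
            measureReal_inter_copyEdges_le F hF place p hp f g
      _ ≤ ∑ f : W → Fin b, q ^ 2 * ((b : ℝ) ^ k + (p : ℝ) ^ 2 * (b + ((p : ℝ) ^ 2)⁻¹) ^ k) := by
          refine Finset.sum_le_sum fun f _ => ?_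
          rw [← Finset.mul_sum, Finset.sum_add_distrib, ← Finset.mul_sum]
          gcongr
          · simp [hk]
          · exact h3 f
      _ = ((b : ℝ) ^ k * q) ^ 2 * (1 + t) := by
          have : (b + ((p : ℝ) ^ 2)⁻¹) = b * (1 + (b * (p : ℝ) ^ 2)⁻¹) := by
            field_simp
          rw [this, mul_pow, ht]
          simp [← hk]
          ring
  have h3 := sq_sum_measureReal_le μ A
  rw [h1] at h3
  have h4 : 1 - t ≤ μ.real (⋃ f, A f) := by
    have h5 : ((b : ℝ) ^ k * q) ^ 2 * 1 ≤
        ((b : ℝ) ^ k * q) ^ 2 * (μ.real (⋃ f, A f) * (1 + t)) := by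
      calc _ ≤ _ := (mul_one _).trans_le h3
        _ ≤ μ.real (⋃ f, A f) * (((b : ℝ) ^ k * q) ^ 2 * (1 + t)) := by gcongr
        _ = _ := by ring
    have h6 := le_of_mul_le_mul_left h5 (by positivity)
    -- With P the probability of the union, 1 ≤ P(1+t) and P ≤ 1 give P ≥ 1-t.
    have h7 : μ.real (⋃ f, A f) ≤ 1 := measureReal_le_one
    nlinarith
  refine h4.trans (measureReal_mono ?_)
  rintro Γ hΓ
  obtain ⟨f, hf⟩ := Set.mem_iUnion.1 hΓ
  exact ⟨partiteEmbedding place f, copyEdges_subset_iff.1 hf⟩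

/-! ### The book graph and its density -/

/-- The graph on `Fin m` in which `1` and `2` are joined to every other vertex, and in which
the only further edge joins `0` and `3`. -/
def bookGraph (m : ℕ) : SimpleGraph (Fin m) where
  Adj y z := y ≠ z ∧ ((y.val = 1 ∨ y.val = 2) ∨ (z.val = 1 ∨ z.val = 2) ∨
    (y.val = 0 ∨ y.val = 3) ∧ (z.val = 0 ∨ z.val = 3))
  symm := ⟨fun y z h => ⟨h.1.symm, by tauto⟩⟩
  loopless := ⟨fun y h => h.1 rfl⟩

instance instDecidableRelBookGraph (m : ℕ) : DecidableRel (bookGraph m).Adj := fun y z =>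
  inferInstanceAs (Decidable (y ≠ z ∧ _))

theorem graphF_eq_bookGraph : graphF = bookGraph 6 := by
  ext y z
  revert y z
  simp only [graphF, SimpleGraph.fromEdgeSet_adj, Set.mem_insert_iff, Set.mem_singleton_iff]
  decide

theorem card_filter_val_le_two {m : ℕ} (S : Finset (Fin m)) (i j : ℕ) :
    (S.filter fun y => y.val = i ∨ y.val = j).card ≤ 2 := by
  have : (S.filter fun y => y.val = i ∨ y.val = j).card ≤ ({i, j} : Finset ℕ).card := by
    refine Finset.card_le_card_of_injOn Fin.val (fun y hy => ?_) Fin.val_injective.injOn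
    simpa using (Finset.mem_filter.1 hy).2
  exact this.trans Finset.card_le_two

/-- Split S into P (its part in {1, 2}) and the rest Q, and let R be its part in {0, 3}. An edge
joins P to Q, lies inside P, or lies inside R, so there are at most |P||Q| + C(|P|,2) + C(|R|,2)
edges, where |P|, |R| ≤ 2 and |R| ≤ |Q|. -/
theorem ncard_edgeSet_bookGraph_inter_sym2_le {m : ℕ} (S : Finset (Fin m)) (hS : S.Nonempty) :
    {e ∈ (bookGraph m).edgeSet | e ∈ S.sym2}.ncard + 2 ≤ 2 * S.card := by
  classical
  set P := S.filter fun y => y.val = 1 ∨ y.val = 2 with hP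
  set Q := S.filter fun y => ¬ (y.val = 1 ∨ y.val = 2) with hQ
  set R := S.filter fun y => y.val = 0 ∨ y.val = 3 with hR
  have hsub : {e ∈ (bookGraph m).edgeSet | e ∈ S.sym2} ⊆
      (((P ×ˢ Q).image (fun y => s(y.1, y.2)) ∪ P.offDiag.image Sym2.mk.uncurry ∪
        R.offDiag.image Sym2.mk.uncurry : Finset (Sym2 (Fin m))) : Set (Sym2 (Fin m))) := by
    rintro e ⟨he, heS⟩
    induction e with | _ y z =>
    rw [Finset.mk_mem_sym2_iff] at heS
    have hyz : (bookGraph m).Adj y z := he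
    obtain ⟨hne, hyz⟩ := hyz
    simp only [Finset.coe_union, Finset.coe_image, Set.mem_union, Set.mem_image, Finset.mem_coe]
    by_cases hy : y.val = 1 ∨ y.val = 2
    · by_cases hz : z.val = 1 ∨ z.val = 2
      · exact .inl (.inr ⟨(y, z), by simp [hP, heS, hy, hz, hne], rfl⟩)
      · exact .inl (.inl ⟨(y, z), Finset.mk_mem_product (Finset.mem_filter.2 ⟨heS.1, hy⟩)
          (Finset.mem_filter.2 ⟨heS.2, hz⟩), rfl⟩)
    · by_cases hz : z.val = 1 ∨ z.val = 2
      · exact .inl (.inl ⟨(z, y), Finset.mk_mem_product (Finset.mem_filter.2 ⟨heS.2, hz⟩)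
          (Finset.mem_filter.2 ⟨heS.1, hy⟩), Sym2.eq_swap⟩)
      · obtain ⟨hy', hz'⟩ := (hyz.resolve_left hy).resolve_left hz
        exact .inr ⟨(y, z), by simp [hR, heS, hy', hz', hne], rfl⟩
  have h1 := (Set.ncard_le_ncard hsub (Set.toFinite _))
  rw [Set.ncard_coe_finset] at h1
  have h2 := h1.trans ((Finset.card_union_le _ _).trans
    (Nat.add_le_add_right (Finset.card_union_le _ _) _))
  have h3 : ((P ×ˢ Q).image (fun y => s(y.1, y.2))).card ≤ P.card * Q.card :=
    Finset.card_image_le.trans (Finset.card_product _ _).le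
  have h4 : P.card + Q.card = S.card := Finset.card_filter_add_card_filter_not _
  have h5 : R.card ≤ Q.card := Finset.card_le_card fun y hy => by
    simp only [hR, hQ, Finset.mem_filter] at hy ⊢
    refine ⟨hy.1, ?_⟩
    omega
  have h6 : P.card ≤ 2 := card_filter_val_le_two S 1 2
  have h7 : R.card ≤ 2 := card_filter_val_le_two S 0 3
  have h8 : 0 < S.card := hS.card_pos
  -- Truncated subtraction makes this correct at 0 and linearises the count for `omega`.
  have h9 : ∀ a ≤ 2, a.choose 2 = a - 1 := by decide
  rw [Sym2.card_image_offDiag, Sym2.card_image_offDiag, h9 _ h6, h9 _ h7] at h2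
  generalize P.card = a at *
  generalize R.card = c at *
  interval_cases a <;> omega

theorem sq_le_extensionCount {n D : ℕ} (Γ : SimpleGraph (Fin n)) (g : Fin (2 * D + 4) ↪ Fin n)
    (hg : ∀ a b, (bookGraph (2 * D + 4)).Adj a b → Γ.Adj (g a) (g b)) :
    D ^ 2 ≤ extensionCount graphF (singleRoot 0) (singleRoot (g 0)) Γ := by
  -- Vertices 4 and 5 go to separate blocks of D pages, so the pair can be read off the vertex set
  -- even though 4 and 5 are interchangeable in the graph.
  let ψ : Fin D × Fin D → Fin 6 ↪ Fin (2 * D + 4) := fun a =>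
    ⟨fun i => ⟨if i.val < 4 then i.val else if i.val = 4 then 4 + a.1.val else 4 + D + a.2.val, by
      have := a.1.2
      have := a.2.2
      split_ifs <;> omega⟩, by
      intro i j hij
      have := a.1.2
      have := a.2.2
      have hij := congrArg Fin.val hij
      simp only at hij
      ext
      split_ifs at hij <;> omega⟩
  have hψ : ∀ a i, (ψ a i).val =
    if i.val < 4 then i.val else if i.val = 4 then 4 + a.1.val else 4 + D + a.2.val :=
    fun a i => rfl
  have h := card_le_extensionCount (bookGraph 6) (singleRoot 0) (singleRoot (g 0)) Γ
    (Finset.univ : Finset (Fin D × Fin D)) (fun a => (ψ a).trans g) ?_ ?_ ?_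
  · rw [graphF_eq_bookGraph]
    simpa [pow_two] using h
  · rintro a - i j ⟨hne, hij⟩
    refine hg _ _ ⟨(ψ a).injective.ne hne, ?_⟩
    rw [hψ, hψ]
    split_ifs <;> omega
  · rintro a -
    rfl
  · rintro a - c - hac
    have hac : Set.range (g ∘ ψ a) = Set.range (g ∘ ψ c) := hac
    rw [Set.range_comp, Set.range_comp] at hac
    replace hac := g.injective.image_injective hac
    have h4 : ψ a 4 ∈ Set.range (ψ c) := hac ▸ ⟨4, rfl⟩
    have h5 : ψ a 5 ∈ Set.range (ψ c) := hac ▸ ⟨5, rfl⟩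
    obtain ⟨i, hi⟩ := h4
    obtain ⟨j, hj⟩ := h5
    have hi := congrArg Fin.val hi
    have hj := congrArg Fin.val hj
    rw [hψ, hψ] at hi hj
    have := a.1.2
    have := a.2.2
    have := c.1.2
    have := c.2.2
    have e4 : (4 : Fin 6).val = 4 := rfl
    have e5 : (5 : Fin 6).val = 5 := rfl
    rw [e4] at hi
    rw [e5] at hj
    ext
    · split_ifs at hi <;> omega
    · split_ifs at hj <;> omega

/-! ### The orders of the means and of Φ -/

theorem div_two_mul_le_cast_div {n k : ℕ} (hk : 0 < k) (hn : k ≤ n) :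
    (n : ℝ) / (2 * k) ≤ ((n / k : ℕ) : ℝ) := by
  have h1 : n < k * (n / k + 1) := Nat.lt_mul_div_succ n hk
  have h2 : 1 ≤ n / k := Nat.div_pos hn hk
  rw [div_le_iff₀ (by positivity)]
  have h3 : n ≤ (n / k) * (2 * k) := by nlinarith
  exact mod_cast h3

/-- Classes of size ⌊n/6⌋ ≥ n/12 and at most five non-root vertices account for the constant 12⁵. -/
theorem le_mean_of_card_le {W : Type} [Fintype W] (H : SimpleGraph W) (r : Fin 1 ↪ W) {n : ℕ}
    (hW : Fintype.card W ≤ 6) (hn : 6 ≤ n) (p : unitInterval) :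
    ((n : ℝ) ^ (Fintype.card W - 1) * (p : ℝ) ^ H.edgeSet.ncard) / 12 ^ 5 ≤ mean H r n p := by
  have hp := p.2.1
  refine le_trans ?_ (le_mean H r n (n / 6) (Nat.div_pos hn (by norm_num)) ?_ p)
  · have h1 := div_two_mul_le_cast_div (k := 6) (by norm_num) hn
    calc _ = (n : ℝ) ^ (Fintype.card W - 1) / 12 ^ 5 * (p : ℝ) ^ H.edgeSet.ncard := by ring
      _ ≤ (n : ℝ) ^ (Fintype.card W - 1) / 12 ^ (Fintype.card W - 1) *
          (p : ℝ) ^ H.edgeSet.ncard := by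
        gcongr
        · norm_num
        · omega
      _ = ((n : ℝ) / (2 * (6 : ℕ))) ^ (Fintype.card W - 1) * (p : ℝ) ^ H.edgeSet.ncard := by
        rw [div_pow]; norm_num
      _ ≤ _ := by gcongr
  · exact (Nat.mul_le_mul_right _ hW).trans (Nat.mul_div_le n 6)

theorem ncard_edgeSet_top_fin_four : (⊤ : SimpleGraph (Fin 4)).edgeSet.ncard = 6 := by
  rw [← SimpleGraph.coe_edgeFinset, Set.ncard_coe_finset]
  rfl

theorem ncard_edgeSet_graphF : graphF.edgeSet.ncard = 10 := by
  rw [graphF_eq_bookGraph, ← SimpleGraph.coe_edgeFinset, Set.ncard_coe_finset]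
  decide

theorem mean_graphF_le (n : ℕ) (p : unitInterval) :
    mean graphF (singleRoot 0) n p ≤ ((n : ℝ) * (p : ℝ) ^ 2) ^ 5 := by
  refine (mean_le graphF (singleRoot 0) n p).trans_eq ?_
  rw [ncard_edgeSet_graphF, Fintype.card_fin]
  ring

theorem mean_top_fin_four_le (n : ℕ) (p : unitInterval) :
    mean (⊤ : SimpleGraph (Fin 4)) (singleRoot 0) n p ≤ ((n : ℝ) * (p : ℝ) ^ 2) ^ 3 := by
  refine (mean_le _ (singleRoot 0) n p).trans_eq ?_
  rw [ncard_edgeSet_top_fin_four, Fintype.card_fin]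
  ring

theorem le_mean_top_fin_four {n : ℕ} (hn : 6 ≤ n) (p : unitInterval) :
    ((n : ℝ) * (p : ℝ) ^ 2) ^ 3 / 12 ^ 5 ≤ mean (⊤ : SimpleGraph (Fin 4)) (singleRoot 0) n p := by
  refine le_of_eq_of_le ?_ (le_mean_of_card_le _ (singleRoot 0) (by simp) hn p)
  rw [ncard_edgeSet_top_fin_four, Fintype.card_fin]
  ring

theorem ncard_edgeSet_coe {W : Type} {H : SimpleGraph W} (J : H.Subgraph) :
    J.coe.edgeSet.ncard = J.edgeSet.ncard := by
  rw [← Set.ncard_image_of_injective _ (Sym2.map.injective Subtype.val_injective),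
    SimpleGraph.Subgraph.image_coe_edgeSet_coe]

theorem mean_nonneg {W : Type} {k : ℕ} (H : SimpleGraph W) (r : Fin k ↪ W) (n : ℕ)
    (p : unitInterval) : 0 ≤ mean H r n p := by
  rw [mean]
  split_ifs
  · exact integral_nonneg fun _ => Nat.cast_nonneg _
  · exact le_rfl

/-- For a ≥ 3, e ≤ 2a already gives n^a p^e ≥ ω^a ≥ ω³. For a = 1 and a = 2 the edge count is at
most 1 and 3, so the values are at least np = ω/p and n²p³ = ω²/p, and ω²p ≤ 1 makes both at least
ω³. -/
theorem pow_three_le_of_density {n a e : ℕ} {p : ℝ} (hp : 0 < p) (hp1 : p ≤ 1)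
    (h1 : 1 ≤ n * p ^ 2) (h2 : (n * p ^ 2) ^ 2 * p ≤ 1) (he : 0 < e) (hea : e ≤ 2 * a)
    (hec : e ≤ (a + 1).choose 2) : (n * p ^ 2) ^ 3 ≤ (n : ℝ) ^ a * p ^ e := by
  set ω := n * p ^ 2 with hω
  have hω0 : 0 < ω := by linarith
  by_cases ha : 3 ≤ a
  · calc ω ^ 3 ≤ ω ^ a := pow_le_pow_right₀ h1 ha
      _ = (n : ℝ) ^ a * p ^ (2 * a) := by rw [hω, mul_pow, pow_mul]
      _ ≤ _ := by
        gcongr ?_ * ?_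
        exact pow_le_pow_of_le_one hp.le hp1 hea
  · have h3 : ω * p ≤ 1 := by
      refine le_trans ?_ h2
      gcongr
      nlinarith
    obtain rfl | rfl : a = 1 ∨ a = 2 := by omega
    · have : e = 1 := by simp [Nat.choose] at hec; omega
      subst this
      have : (n : ℝ) ^ 1 * p ^ 1 * p = ω := by rw [hω]; ring
      refine le_of_mul_le_mul_right ?_ hp
      rw [this]
      calc ω ^ 3 * p = ω * (ω ^ 2 * p) := by ring
        _ ≤ ω * 1 := by gcongr
        _ = ω := mul_one _
    · have hec : e ≤ 3 := by simpa [Nat.choose] using hec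
      have : (n : ℝ) ^ 2 * p ^ 3 * p = ω ^ 2 := by rw [hω]; ring
      refine le_trans ?_ (show (n : ℝ) ^ 2 * p ^ 3 ≤ _ by
        gcongr ?_ * ?_
        exact pow_le_pow_of_le_one hp.le hp1 hec)
      refine le_of_mul_le_mul_right ?_ hp
      rw [this]
      calc ω ^ 3 * p = ω ^ 2 * (ω * p) := by ring
        _ ≤ ω ^ 2 * 1 := by gcongr
        _ = ω ^ 2 := mul_one _

theorem edgeSet_rootSubgraph_singleRoot {W : Type} (H : SimpleGraph W) (v : W) :
    (rootSubgraph H (singleRoot v)).edgeSet = ∅ := by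
  rw [Set.eq_empty_iff_forall_notMem]
  intro e he
  induction e with | _ a b =>
  have : (rootSubgraph H (singleRoot v)).Adj a b := he
  simp only [rootSubgraph, SimpleGraph.Subgraph.induce_adj, Set.mem_range,
    SimpleGraph.Subgraph.top_adj] at this
  obtain ⟨⟨i, rfl⟩, ⟨j, rfl⟩, h⟩ := this
  exact h.ne (by rw [Subsingleton.elim i j])

theorem ncard_edgeSet_add_two_le (J : graphF.Subgraph) [Fintype J.verts]
    (hJ : J.verts.Nonempty) : J.edgeSet.ncard + 2 ≤ 2 * Fintype.card J.verts := by
  have h := ncard_edgeSet_bookGraph_inter_sym2_le J.verts.toFinset (Set.toFinset_nonempty.2 hJ)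
  rw [Set.toFinset_card] at h
  refine (Nat.add_le_add_right (Set.ncard_le_ncard ?_ (Set.toFinite _)) 2).trans h
  intro e he
  induction e with | _ a b =>
  have hab : J.Adj a b := he
  refine ⟨?_, ?_⟩
  · rw [← graphF_eq_bookGraph]
    exact J.edgeSet_subset he
  · rw [Finset.mk_mem_sym2_iff]
    simp [J.edge_vert hab, J.edge_vert hab.symm]

theorem le_Phi_graphF {n : ℕ} {p : unitInterval} (hn : 6 ≤ n) (hp : 0 < (p : ℝ))
    (h1 : 1 ≤ (n : ℝ) * (p : ℝ) ^ 2) (h2 : ((n : ℝ) * (p : ℝ) ^ 2) ^ 2 * p ≤ 1)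
    (hne : Nonempty {J : graphF.Subgraph // rootSubgraph graphF (singleRoot 0) ≤ J ∧
      (rootSubgraph graphF (singleRoot 0)).edgeSet.ncard < J.edgeSet.ncard}) :
    ((n : ℝ) * (p : ℝ) ^ 2) ^ 3 / 12 ^ 5 ≤ Phi graphF (singleRoot 0) n p := by
  classical
  refine le_ciInf fun ⟨J, hJ, hJe⟩ => ?_
  have := Fintype.ofFinite J.verts
  rw [edgeSet_rootSubgraph_singleRoot, Set.ncard_empty] at hJe
  have hv : Fintype.card J.verts ≤ 6 := by
    simpa using Fintype.card_le_of_injective _ (Subtype.val_injective (p := (· ∈ J.verts)))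
  refine le_trans ?_ (le_mean_of_card_le J.coe _ hv hn p)
  gcongr
  rw [ncard_edgeSet_coe]
  have hJn : J.verts.Nonempty := ⟨0, hJ.1 ⟨0, rfl⟩⟩
  have hpos : 0 < Fintype.card J.verts := Fintype.card_pos_iff.2 hJn.to_subtype
  have hd := ncard_edgeSet_add_two_le J hJn
  refine pow_three_le_of_density hp p.2.2 h1 h2 hJe (by omega) ?_
  rw [Nat.sub_add_cancel hpos, ← ncard_edgeSet_coe, ← SimpleGraph.coe_edgeFinset,
    Set.ncard_coe_finset]
  exact J.coe.card_edgeFinset_le_card_choose_two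

/-- The copy of `K₄` on the vertices `0, 1, 2, 3` of `graphF`. -/
def subgraphFour : graphF.Subgraph := (⊤ : graphF.Subgraph).induce {0, 1, 2, 3}

theorem rootSubgraph_le_subgraphFour : rootSubgraph graphF (singleRoot 0) ≤ subgraphFour := by
  refine SimpleGraph.Subgraph.induce_mono_right ?_
  rintro _ ⟨j, rfl⟩
  exact Set.mem_insert _ _

theorem ncard_edgeSet_subgraphFour : subgraphFour.edgeSet.ncard = 6 := by
  have h : subgraphFour.edgeSet = ((bookGraph 6).edgeFinset.filter
      fun e => e ∈ ({0, 1, 2, 3} : Finset (Fin 6)).sym2 : Finset (Sym2 (Fin 6))) := by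
    ext e
    induction e with | _ a b =>
    rw [SimpleGraph.Subgraph.mem_edgeSet, Finset.mem_coe, Finset.mem_filter,
      Finset.mk_mem_sym2_iff, SimpleGraph.mem_edgeFinset, SimpleGraph.mem_edgeSet,
      ← graphF_eq_bookGraph]
    simp [subgraphFour]
    tauto
  rw [h, Set.ncard_coe_finset]
  decide

theorem nonempty_extension_subgraphs_graphF :
    Nonempty {J : graphF.Subgraph // rootSubgraph graphF (singleRoot 0) ≤ J ∧
      (rootSubgraph graphF (singleRoot 0)).edgeSet.ncard < J.edgeSet.ncard} :=
  ⟨subgraphFour, rootSubgraph_le_subgraphFour, by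
    rw [edgeSet_rootSubgraph_singleRoot, ncard_edgeSet_subgraphFour]; simp⟩

theorem Phi_le_mean {W : Type} [Finite W] {k : ℕ} (H : SimpleGraph W) (r : Fin k ↪ W)
    (J : H.Subgraph) (hJ : rootSubgraph H r ≤ J)
    (he : (rootSubgraph H r).edgeSet.ncard < J.edgeSet.ncard) (n : ℕ) (p : unitInterval) :
    Phi H r n p ≤ mean J.coe (restrictRoots H r J hJ) n p := by
  refine ciInf_le (f := fun J : {J : H.Subgraph // rootSubgraph H r ≤ J ∧
    (rootSubgraph H r).edgeSet.ncard < J.edgeSet.ncard} =>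
      mean J.1.coe (restrictRoots H r J.1 J.2.1) n p) ⟨0, ?_⟩ ⟨J, hJ, he⟩
  rintro _ ⟨J, rfl⟩
  exact mean_nonneg _ _ _ _

theorem card_verts_subgraphFour [Fintype subgraphFour.verts] :
    Fintype.card subgraphFour.verts = 4 := by
  have : subgraphFour.verts = ({0, 1, 2, 3} : Finset (Fin 6)) := by
    simp [subgraphFour]
  rw [← Nat.card_eq_fintype_card, Nat.card_coe_set_eq, this, Set.ncard_coe_finset]
  rfl

theorem Phi_graphF_le (n : ℕ) (p : unitInterval) :
    Phi graphF (singleRoot 0) n p ≤ ((n : ℝ) * (p : ℝ) ^ 2) ^ 3 := by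
  have := Fintype.ofFinite subgraphFour.verts
  have he : (rootSubgraph graphF (singleRoot 0)).edgeSet.ncard < subgraphFour.edgeSet.ncard := by
    rw [edgeSet_rootSubgraph_singleRoot, ncard_edgeSet_subgraphFour, Set.ncard_empty]
    norm_num
  have hm := mean_le subgraphFour.coe
    (restrictRoots graphF (singleRoot 0) subgraphFour rootSubgraph_le_subgraphFour) n p
  rw [ncard_edgeSet_coe, ncard_edgeSet_subgraphFour, card_verts_subgraphFour] at hm
  refine (Phi_le_mean _ _ subgraphFour rootSubgraph_le_subgraphFour he n p).trans (hm.trans_eq ?_)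
  ring

/-! ### From a large book to a root with too many extensions -/

theorem one_sub_le_tooManyProb {n D : ℕ} {p : unitInterval} {ε : ℝ} (hε : ε ≤ 1)
    (hn : 2 * D + 4 ≤ n) (hp : 0 < (p : ℝ)) (h1 : 1 ≤ (n : ℝ) * (p : ℝ) ^ 2)
    (h2 : 2 * ((n : ℝ) * (p : ℝ) ^ 2) ^ 5 ≤ (D : ℝ) ^ 2) :
    1 - (p : ℝ) ^ 2 * (1 + 2 * ((2 * D + 4 : ℕ) : ℝ)) ^ (2 * D + 4) ≤
      tooManyProb graphF (singleRoot 0) n p ε := by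
  set k := 2 * D + 4 with hk
  have hk0 : 0 < k := by omega
  have hb : 0 < n / k := Nat.div_pos hn hk0
  obtain ⟨place⟩ : Nonempty (Fin k × Fin (n / k) ↪ Fin n) :=
    Function.Embedding.nonempty_of_card_le (by simpa using Nat.mul_div_le n k)
  have h3 := one_sub_le_measureReal_exists_copy hb (bookGraph k)
    ncard_edgeSet_bookGraph_inter_sym2_le place p hp
  rw [Fintype.card_fin] at h3
  -- The classes have size ⌊n/k⌋ ≥ n/(2k), and ω ≥ 1.
  have h4 : (((n / k : ℕ) : ℝ) * (p : ℝ) ^ 2)⁻¹ ≤ 2 * k := by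
    have := div_two_mul_le_cast_div hk0 hn
    have h5 : (2 * (k : ℝ))⁻¹ ≤ ((n / k : ℕ) : ℝ) * (p : ℝ) ^ 2 := by
      calc (2 * (k : ℝ))⁻¹ ≤ (2 * (k : ℝ))⁻¹ * (n * (p : ℝ) ^ 2) :=
            le_mul_of_one_le_right (by positivity) h1
        _ = n / (2 * k) * (p : ℝ) ^ 2 := by ring
        _ ≤ _ := by gcongr
    exact inv_le_of_inv_le₀ (by positivity) h5
  refine le_trans ?_ (h3.trans (measureReal_mono ?_))
  · gcongr
  · rintro Γ ⟨g, hg⟩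
    refine ⟨singleRoot (g 0), ?_⟩
    have h5 := sq_le_extensionCount Γ g hg
    calc (1 + ε) * mean graphF (singleRoot 0) n p ≤ 2 * ((n : ℝ) * (p : ℝ) ^ 2) ^ 5 := by
          refine mul_le_mul (by linarith) (mean_graphF_le n p) (mean_nonneg _ _ _ _) (by norm_num)
      _ ≤ (D : ℝ) ^ 2 := h2
      _ ≤ _ := mod_cast h5

theorem concentrationProb_le {W : Type} {k : ℕ} (H : SimpleGraph W) (r : Fin k ↪ W) (n : ℕ)
    (p : unitInterval) (ε : ℝ) :
    concentrationProb H r n p ε ≤ 1 - tooManyProb H r n p ε := by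
  rw [concentrationProb, tooManyProb,
    ← probReal_compl_eq_one_sub (Set.toFinite _).measurableSet]
  refine measureReal_mono ?_
  rintro Γ hΓ ⟨x, hx⟩
  have hΓ : (⨆ x : Fin k ↪ Fin n, |(extensionCount H r x Γ : ℝ) - mean H r n p|)
      < ε * mean H r n p := hΓ
  refine hΓ.not_ge ?_
  refine le_trans ?_ (le_ciSup (f := fun x : Fin k ↪ Fin n =>
    |(extensionCount H r x Γ : ℝ) - mean H r n p|) (Set.toFinite _).bddAbove x)
  exact le_trans (by linarith) (le_abs_self _)

/-! ### Asymptotics -/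

theorem eventually_rpow_mul_le_rpow {s t : ℝ} (hst : s < t) (c : ℝ) :
    ∀ᶠ x : ℝ in atTop, c * x ^ s ≤ x ^ t := by
  filter_upwards [(tendsto_rpow_atTop (sub_pos.2 hst)).eventually_ge_atTop c,
    eventually_gt_atTop 0] with x hx hx0
  calc c * x ^ s ≤ x ^ (t - s) * x ^ s := by gcongr
    _ = x ^ t := by rw [← Real.rpow_add hx0, sub_add_cancel]

/-- Applied with x = log n and k the number of vertices of the book: k ≤ 3x^0.98 and log(1+2k) ≤
x^0.01, so the logarithm of the power is at most 3x^0.99 ≤ x/2. The threshold 26 ensures 1+2k ≤ 13 +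
4x^0.98 ≤ x. -/
theorem eventually_pow_self_le_exp :
    ∀ᶠ x : ℝ in atTop, ∀ k : ℕ, (k : ℝ) ≤ 2 * x ^ (0.98 : ℝ) + 6 →
      (k : ℝ) ≤ x ∧ (1 + 2 * (k : ℝ)) ^ k ≤ Real.exp (x / 2) := by
  filter_upwards [eventually_rpow_mul_le_rpow (show (0.98 : ℝ) < 1 by norm_num) 8,
    eventually_rpow_mul_le_rpow (show (0.99 : ℝ) < 1 by norm_num) 6,
    eventually_rpow_mul_le_rpow (show (0 : ℝ) < 0.98 by norm_num) 6,
    (isLittleO_log_rpow_atTop (show (0 : ℝ) < 0.01 by norm_num)).bound (zero_lt_one),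
    eventually_ge_atTop 26] with x h1 h2 h3 h4 h5 k hk
  have hx0 : 0 < x := lt_of_lt_of_le (by norm_num) h5
  rw [Real.rpow_one] at h1 h2
  rw [Real.rpow_zero] at h3
  rw [one_mul, Real.norm_of_nonneg (Real.log_nonneg (by linarith)),
    Real.norm_of_nonneg (by positivity)] at h4
  have hkx : 1 + 2 * (k : ℝ) ≤ x := by linarith
  refine ⟨by linarith [Nat.cast_nonneg (α := ℝ) k], ?_⟩
  have hpos : 0 < 1 + 2 * (k : ℝ) := by positivity
  rw [← Real.exp_log hpos, ← Real.exp_nat_mul, Real.exp_le_exp]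
  calc (k : ℝ) * Real.log (1 + 2 * k) ≤ (3 * x ^ (0.98 : ℝ)) * x ^ (0.01 : ℝ) := by
        refine mul_le_mul (by linarith) ((Real.log_le_log hpos hkx).trans h4)
          (Real.log_nonneg (by linarith [Nat.cast_nonneg (α := ℝ) k])) (by positivity)
    _ = 3 * x ^ (0.99 : ℝ) := by
        rw [mul_assoc, ← Real.rpow_add hx0]; norm_num
    _ ≤ x / 2 := by linarith

theorem tendsto_log_natCast : Tendsto (fun n : ℕ => Real.log (n : ℝ)) atTop atTop :=
  Real.tendsto_log_atTop.comp tendsto_natCast_atTop_atTop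

section Window

variable {p : ℕ → unitInterval} {ε : ℕ → ℝ}

/-- The bound ω ≥ 1 comes from 1 ≤ log n ≤ ε²ω³ ≤ ω³, and it forces p > 0. -/
theorem eventually_window (hε : ∀ n, ε n ∈ Set.Ioc (0 : ℝ) 1)
    (h1 : (fun n : ℕ => (n : ℝ) * (p n : ℝ) ^ 2) =o[atTop]
      (fun n : ℕ => Real.log (n : ℝ) ^ (0.39 : ℝ)))
    (h2 : (fun n : ℕ => Real.log (n : ℝ)) =o[atTop]
      (fun n : ℕ => ε n ^ 2 * ((n : ℝ) * (p n : ℝ) ^ 2) ^ 3)) :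
    ∀ᶠ n : ℕ in atTop, 6 ≤ n ∧ 0 < (p n : ℝ) ∧ 1 ≤ (n : ℝ) * (p n : ℝ) ^ 2 ∧
      (n : ℝ) * (p n : ℝ) ^ 2 ≤ Real.log n ^ (0.39 : ℝ) := by
  filter_upwards [h1.bound zero_lt_one, h2.bound zero_lt_one,
    tendsto_log_natCast.eventually_ge_atTop 1, eventually_ge_atTop 6] with n h1 h2 h3 h4
  have hω : 0 ≤ (n : ℝ) * (p n : ℝ) ^ 2 := by positivity
  have hε2 : ε n ^ 2 ≤ 1 := pow_le_one₀ (hε n).1.le (hε n).2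
  rw [one_mul, Real.norm_of_nonneg hω,
    Real.norm_of_nonneg (Real.rpow_nonneg (by linarith) _)] at h1
  rw [one_mul, Real.norm_of_nonneg (by linarith), Real.norm_of_nonneg (by positivity)] at h2
  have h5 : 1 ≤ (n : ℝ) * (p n : ℝ) ^ 2 := by
    have : 1 ≤ ((n : ℝ) * (p n : ℝ) ^ 2) ^ 3 :=
      (h3.trans h2).trans (mul_le_of_le_one_left (by positivity) hε2)
    by_contra! h
    exact absurd this (not_le.2 (pow_lt_one₀ hω h (by norm_num)))
  refine ⟨h4, (p n).2.1.lt_of_ne fun h => ?_, h5, h1⟩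
  rw [← h] at h5
  norm_num at h5

theorem pow_five_le {n : ℕ} {q : ℝ} (hn : 1 ≤ n)
    (h : (n : ℝ) * q ^ 2 ≤ Real.log n ^ (0.39 : ℝ)) :
    ((n : ℝ) * q ^ 2) ^ 5 ≤ Real.log n ^ (1.95 : ℝ) := by
  have hL : 0 ≤ Real.log n := Real.log_nonneg (mod_cast hn)
  calc _ ≤ (Real.log n ^ (0.39 : ℝ)) ^ 5 := by gcongr
    _ = _ := by rw [← Real.rpow_natCast, ← Real.rpow_mul hL]; norm_num

theorem Phi_nonneg {W : Type} {k : ℕ} (H : SimpleGraph W) (r : Fin k ↪ W) (n : ℕ)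
    (p : unitInterval) : 0 ≤ Phi H r n p :=
  Real.iInf_nonneg fun _ => mean_nonneg _ _ _ _

theorem isTheta_Phi_graphF (hw : ∀ᶠ n : ℕ in atTop, 6 ≤ n ∧ 0 < (p n : ℝ) ∧
      1 ≤ (n : ℝ) * (p n : ℝ) ^ 2 ∧ (n : ℝ) * (p n : ℝ) ^ 2 ≤ Real.log n ^ (0.39 : ℝ)) :
    (fun n : ℕ => ε n ^ 2 * Phi graphF (singleRoot 0) n (p n)) =Θ[atTop]
      (fun n : ℕ => ε n ^ 2 * mean (⊤ : SimpleGraph (Fin 4)) (singleRoot 0) n (p n)) := by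
  have hexp : ∀ᶠ n : ℕ in atTop, Real.log n ^ (1.95 : ℝ) ≤ n := by
    filter_upwards [tendsto_log_natCast.eventually
      ((isLittleO_rpow_exp_atTop 1.95).bound zero_lt_one),
      tendsto_log_natCast.eventually_ge_atTop 0, eventually_gt_atTop 0] with n h h' hn
    rw [one_mul, Real.norm_of_nonneg (Real.rpow_nonneg h' _), Real.norm_of_nonneg
      (Real.exp_nonneg _), Real.exp_log (mod_cast hn)] at h
    exact h
  refine (isTheta_refl (fun n => ε n ^ 2) atTop).mul ⟨.of_bound (12 ^ 5) ?_, .of_bound (12 ^ 5) ?_⟩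
  · filter_upwards [hw] with n ⟨hn, hp, h1, h2⟩
    have h3 := le_mean_top_fin_four hn (p n)
    have h4 := Phi_graphF_le n (p n)
    rw [Real.norm_of_nonneg (mean_nonneg _ _ _ _), Real.norm_of_nonneg
      (Phi_nonneg _ _ _ _)]
    linarith
  · filter_upwards [hw, hexp] with n ⟨hn, hp, h1, h2⟩ he
    have h5 : ((n : ℝ) * (p n : ℝ) ^ 2) ^ 2 * p n ≤ 1 := by
      -- The condition ω²p ≤ 1 is equivalent to ω⁵ ≤ n, which holds because ω is polylogarithmic.
      have h6 : (((n : ℝ) * (p n : ℝ) ^ 2) ^ 2 * p n) ^ 2 * n = ((n : ℝ) * (p n : ℝ) ^ 2) ^ 5 := by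
        ring
      have h7 := (pow_five_le (by omega) h2).trans he
      rw [← h6] at h7
      have hn0 : (0 : ℝ) < n := by positivity
      have h8 := (mul_le_iff_le_one_left hn0).1 h7
      exact (sq_le_one_iff₀ (by positivity)).1 h8
    have h3 := le_Phi_graphF hn hp h1 h5 nonempty_extension_subgraphs_graphF
    have h4 := mean_top_fin_four_le n (p n)
    rw [Real.norm_of_nonneg (mean_nonneg _ _ _ _), Real.norm_of_nonneg
      (Phi_nonneg _ _ _ _)]
    linarith

theorem isBigO_mean_top_fin_four :
    (fun n : ℕ => ε n ^ 2 * ((n : ℝ) * (p n : ℝ) ^ 2) ^ 3) =O[atTop]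
      (fun n : ℕ => ε n ^ 2 * mean (⊤ : SimpleGraph (Fin 4)) (singleRoot 0) n (p n)) := by
  refine (isBigO_refl (fun n => ε n ^ 2) atTop).mul (.of_bound (12 ^ 5) ?_)
  filter_upwards [eventually_ge_atTop 6] with n hn
  have h3 := le_mean_top_fin_four hn (p n)
  rw [Real.norm_of_nonneg (mean_nonneg _ _ _ _), Real.norm_of_nonneg (by positivity)]
  linarith

theorem tendsto_tooManyProb (hε : ∀ n, ε n ≤ 1) (hw : ∀ᶠ n : ℕ in atTop, 6 ≤ n ∧ 0 < (p n : ℝ) ∧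
      1 ≤ (n : ℝ) * (p n : ℝ) ^ 2 ∧ (n : ℝ) * (p n : ℝ) ^ 2 ≤ Real.log n ^ (0.39 : ℝ)) :
    Tendsto (fun n : ℕ => tooManyProb graphF (singleRoot 0) n (p n) (ε n)) atTop (𝓝 1) := by
  have hlim : Tendsto (fun n : ℕ => 1 - 2 * ((Real.log n / 2) ^ 1 * Real.exp (-(Real.log n / 2))))
      atTop (𝓝 1) := by
    have := (Real.tendsto_pow_mul_exp_neg_atTop_nhds_zero 1).comp
      (tendsto_log_natCast.atTop_div_const (show (0 : ℝ) < 2 by norm_num))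
    simpa using (this.const_mul 2).const_sub 1
  refine tendsto_of_tendsto_of_tendsto_of_le_of_le' hlim tendsto_const_nhds ?_
    (.of_forall fun n => measureReal_le_one)
  filter_upwards [hw, tendsto_log_natCast.eventually eventually_pow_self_le_exp,
    tendsto_log_natCast.eventually
      (eventually_rpow_mul_le_rpow (show (1.95 : ℝ) < 1.96 by norm_num) 2),
    tendsto_log_natCast.eventually_ge_atTop 1]
    with n ⟨hn, hp, h1, h2⟩ hk h3 hL
  have hn0 : (0 : ℝ) < n := by positivity
  set L := Real.log n with hLdef
  -- The exponent must stay below 1, so that k log k = o(L), while its double must exceed 5 · 0.39 =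
  -- 1.95, so that D² beats 2ω⁵.
  set D := ⌈L ^ (0.98 : ℝ)⌉₊ with hD
  have hD1 : L ^ (0.98 : ℝ) ≤ D := Nat.le_ceil _
  have hD2 : (D : ℝ) < L ^ (0.98 : ℝ) + 1 := Nat.ceil_lt_add_one (by positivity)
  obtain ⟨hk1, hk2⟩ := hk (2 * D + 4) (by push_cast; linarith)
  have hkn : 2 * D + 4 ≤ n := by
    have : ((2 * D + 4 : ℕ) : ℝ) ≤ n :=
      hk1.trans ((Real.log_le_sub_one_of_pos hn0).trans (by linarith))
    exact mod_cast this
  refine le_trans ?_ (one_sub_le_tooManyProb (hε n) hkn hp h1 ?_)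
  · have hpn : (p n : ℝ) ^ 2 ≤ L / n := by
      rw [le_div_iff₀ hn0, mul_comm]
      refine h2.trans ?_
      conv_rhs => rw [← Real.rpow_one L]
      exact Real.rpow_le_rpow_of_exponent_le hL (by norm_num)
    refine sub_le_sub_left ?_ _
    -- Since n = exp L, the failure probability is at most L · exp(-L/2).
    calc _ ≤ L / n * Real.exp (L / 2) := by gcongr
      _ = L / Real.exp L * Real.exp (L / 2) := by rw [Real.exp_log hn0]
      _ = 2 * ((L / 2) ^ 1 * (Real.exp (-L) * Real.exp (L / 2))) := by
        rw [Real.exp_neg]; ring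
      _ = _ := by rw [← Real.exp_add]; congr 4; ring
  · calc 2 * ((n : ℝ) * (p n : ℝ) ^ 2) ^ 5 ≤ 2 * L ^ (1.95 : ℝ) := by
          gcongr
          exact pow_five_le (by omega) h2
      _ ≤ L ^ (1.96 : ℝ) := h3
      _ = (L ^ (0.98 : ℝ)) ^ 2 := by
          rw [← Real.rpow_natCast, ← Real.rpow_mul (by linarith)]; norm_num
      _ ≤ _ := by gcongr

theorem tendsto_concentrationProb
    (h : Tendsto (fun n : ℕ => tooManyProb graphF (singleRoot 0) n (p n) (ε n)) atTop (𝓝 1)) :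
    Tendsto (fun n : ℕ => concentrationProb graphF (singleRoot 0) n (p n) (ε n)) atTop (𝓝 0) :=
  squeeze_zero (fun _ => measureReal_nonneg) (fun n => concentrationProb_le _ _ n (p n) (ε n))
    (by simpa using h.const_sub 1)

end Window

/-- The exponent 0.36 lies between 1/3, needed for ω³ ≫ log n, and 0.39. The minimum with 1 only
serves to make p a probability for every n. -/
theorem exists_edge_probability : ∃ p : ℕ → unitInterval,
    ∀ᶠ n : ℕ in atTop, (n : ℝ) * (p n : ℝ) ^ 2 = Real.log n ^ (0.36 : ℝ) := by
  refine ⟨fun n => ⟨min 1 √(Real.log n ^ (0.36 : ℝ) / n), by positivity, min_le_left _ _⟩, ?_⟩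
  filter_upwards [tendsto_log_natCast.eventually_ge_atTop 1, eventually_gt_atTop 0] with n hL hn
  have hn0 : (0 : ℝ) < n := mod_cast hn
  have h1 : Real.log n ^ (0.36 : ℝ) ≤ n := by
    calc _ ≤ Real.log n ^ (1 : ℝ) := Real.rpow_le_rpow_of_exponent_le hL (by norm_num)
      _ = Real.log n := Real.rpow_one _
      _ ≤ n := (Real.log_le_sub_one_of_pos hn0).trans (by linarith)
  have h2 : √(Real.log n ^ (0.36 : ℝ) / n) ≤ 1 := by
    rw [Real.sqrt_le_one]
    exact (div_le_one hn0).2 h1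
  simp only [min_eq_right h2]
  rw [Real.sq_sqrt (by positivity), mul_div_cancel₀ _ hn0.ne']

theorem isLittleO_log_rpow_log_rpow {s t : ℝ} (hst : s < t) :
    (fun n : ℕ => Real.log (n : ℝ) ^ s) =o[atTop] (fun n : ℕ => Real.log (n : ℝ) ^ t) :=
  (IsLittleO.of_bound fun c hc => by
    filter_upwards [eventually_rpow_mul_le_rpow hst c⁻¹, eventually_ge_atTop 0] with x hx hx0
    rw [Real.norm_of_nonneg (by positivity), Real.norm_of_nonneg (by positivity)]
    rwa [inv_mul_le_iff₀ hc] at hx :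
    (fun x : ℝ => x ^ s) =o[atTop] fun x => x ^ t).comp_tendsto tendsto_log_natCast

end ExtensionCounts

theorem proposition7 :
    (∀ (p : ℕ → unitInterval) (ε : ℕ → ℝ), (∀ n, ε n ∈ Set.Ioc (0 : ℝ) 1) →
      (fun n : ℕ => (n : ℝ) * (p n : ℝ) ^ 2) =o[atTop]
        (fun n : ℕ => Real.log (n : ℝ) ^ (0.39 : ℝ)) →
      (fun n : ℕ => Real.log (n : ℝ)) =o[atTop]
        (fun n : ℕ => ε n ^ 2 * ((n : ℝ) * (p n : ℝ) ^ 2) ^ 3) →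
      (fun n : ℕ => ε n ^ 2 * Phi graphF (singleRoot 0) n (p n)) =Θ[atTop]
          (fun n : ℕ => ε n ^ 2 * mean (⊤ : SimpleGraph (Fin 4)) (singleRoot 0) n (p n)) ∧
        (fun n : ℕ => Real.log (n : ℝ)) =o[atTop]
          (fun n : ℕ => ε n ^ 2 * mean (⊤ : SimpleGraph (Fin 4)) (singleRoot 0) n (p n)) ∧
        Tendsto (fun n : ℕ => tooManyProb graphF (singleRoot 0) n (p n) (ε n)) atTop (𝓝 1) ∧
        Tendsto (fun n : ℕ => concentrationProb graphF (singleRoot 0) n (p n) (ε n))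
          atTop (𝓝 0)) ∧
    (∃ (p : ℕ → unitInterval) (ε : ℕ → ℝ), (∀ n, ε n ∈ Set.Ioc (0 : ℝ) 1) ∧
      (fun n : ℕ => Real.log (n : ℝ)) =o[atTop]
        (fun n : ℕ => ε n ^ 2 * Phi graphF (singleRoot 0) n (p n)) ∧
      ¬ Tendsto (fun n : ℕ => concentrationProb graphF (singleRoot 0) n (p n) (ε n))
          atTop (𝓝 1)) := by
  -- The counterexample is the first assertion at ε = 1 and ω = (log n)^0.36, as the concentration
  -- probability cannot tend to both 0 and 1.
  refine and_iff_left_of_imp (fun h => ?_) |>.2 ?_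
  · obtain ⟨p, hp⟩ := exists_edge_probability
    have hε : ∀ n : ℕ, (fun _ : ℕ => (1 : ℝ)) n ∈ Set.Ioc (0 : ℝ) 1 := fun n => by simp
    obtain ⟨h1, h2, -, h4⟩ := h p (fun _ => 1) hε
      ((isLittleO_log_rpow_log_rpow (show (0.36 : ℝ) < 0.39 by norm_num)).congr'
        (hp.mono fun n hn => hn.symm) .rfl)
      ((isLittleO_log_rpow_log_rpow (show (1 : ℝ) < 1.08 by norm_num)).congr'
        (.of_forall fun n => Real.rpow_one _) (by
          filter_upwards [hp, tendsto_log_natCast.eventually_ge_atTop 0] with n hn hL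
          rw [hn, one_pow, one_mul, ← Real.rpow_natCast, ← Real.rpow_mul hL]
          norm_num))
    exact ⟨p, fun _ => 1, hε, h2.trans_isBigO h1.isBigO_symm,
      fun h => zero_ne_one (tendsto_nhds_unique h4 h)⟩
  · intro p ε hε h1 h2
    have hw := eventually_window hε h1 h2
    have h3 := tendsto_tooManyProb (fun n => (hε n).2) hw
    exact ⟨isTheta_Phi_graphF hw, h2.trans_isBigO isBigO_mean_top_fin_four, h3,
      tendsto_concentrationProb h3⟩
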